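/- A \emph{modality} is a finite (possibly empty) sequence of the symbols $\Box$ and $\Diamond$; $\emptyset$ is the empty modality, $A,B,C,\ldots$ range over modalities, and $M\in\{\Box,\Diamond\}$. Arrow terms $f\colon A\vdash B$ are generated from $$1_A\colon A\vdash A,\quad \varepsilon^\Box_A\colon\Box A\vdash A,\quad \varepsilon^\Diamond_A\colon A\vdash\Diamond A,\quad \delta^{\Box M}_A\colon MA\vdash\Box MA,\quad \delta^{\Diamond M}_A\colon \Diamond MA\vdash MA$$ by composition $g\circ f\colon A\vdash C$ (for $f\colon A\vdash B$, $g\colon B\vdash C$) and by $Mf\colon MA\vdash MB$ (for $f\colon A\vdash B$). The category $S5_{\Box\Diamond}$ has the modalities as objects and, as arrows, the classes of arrow terms under the least congruence (with respect to $\circ$, $\Box$ and $\Diamond$) that makes it a category with identities $1_A$, makes $\Box$ and $\Diamond$ functors, and satisfies, for all $f\colon A\vdash B$, all $A$ and all $M$, $$\varepsilon^\Box_B\circ\Box f=f\circ\varepsilon^\Box_A,\qquad \Diamond f\circ\varepsilon^\Diamond_A=\varepsilon^\Diamond_B\circ f,$$ $$\Box Mf\circ\delta^{\Box M}_A=\delta^{\Box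 M}_B\circ Mf,\qquad \delta^{\Diamond M}_B\circ\Diamond Mf=Mf\circ\delta^{\Diamond M}_A,$$ $$\Box\delta^{\Box M}_A\circ\delta^{\Box M}_A=\delta^{\Box\Box}_{MA}\circ\delta^{\Box M}_A,\qquad \delta^{\Diamond M}_A\circ\Diamond\delta^{\Diamond M}_A=\delta^{\Diamond M}_A\circ\delta^{\Diamond\Diamond}_{MA},$$ $$\varepsilon^\Box_{MA}\circ\delta^{\Box M}_A=1_{MA},\quad \delta^{\Diamond M}_A\circ\varepsilon^\Diamond_{MA}=1_{MA},\quad \Box\varepsilon^\Box_A\circ\delta^{\Box\Box}_A=1_{\Box A},\quad \delta^{\Diamond\Diamond}_A\circ\Diamond\varepsilon^\Diamond_A=1_{\Diamond A},$$ $$\Box\delta^{\Diamond M}_A\circ\delta^{\Box\Diamond}_{MA}=\delta^{\Box M}_A\circ\delta^{\Diamond M}_A,\qquad \delta^{\Diamond\Box}_{MA}\circ\Diamond\delta^{\Box M}_A=\delta^{\Box M}_A\circ\delta^{\Diamond M}_A.$$ The six \emph{preordering equations} are \begin{enumerate} \item $\Box\varepsilon^\Box_A=\varepsilon^\Box_{\Box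 A}$; \item $\varepsilon^\Box_A\circ\varepsilon^\Box_{\Box A}\circ\delta^{\Diamond\Box}_{\Box A}=\varepsilon^\Box_A\circ\delta^{\Diamond\Box}_A\circ\Diamond\varepsilon^\Box_{\Box A}$; \item $\Box\varepsilon^\Diamond_A=\delta^{\Box\Diamond}_A\circ\varepsilon^\Diamond_A\circ\varepsilon^\Box_A$; \item $\varepsilon^\Diamond_A\circ\varepsilon^\Box_A\circ\delta^{\Diamond\Box}_A=\Diamond\varepsilon^\Box_A$; \item $\Box\varepsilon^\Diamond_{\Diamond A}\circ\delta^{\Box\Diamond}_A\circ\varepsilon^\Diamond_A=\delta^{\Box\Diamond}_{\Diamond A}\circ\varepsilon^\Diamond_{\Diamond A}\circ\varepsilon^\Diamond_A$; \item $\varepsilon^\Diamond_{\Diamond A}=\Diamond\varepsilon^\Diamond_A$. \end{enumerate} Let $S5_{\Box\Diamond triv}$ be defined like $S5_{\Box\Diamond}$, with any one of these six equations assumed in addition for all modalities $A$. Then: \begin{itemize} \item $S5_{\Box\Diamond triv}$ is a preorder: any two arrows with the same source and the same target are equal; \item its skeleton is given by the diagram $\Box\xrightarrow{\ \varepsilon^\Box_\emptyset\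 }\emptyset\xrightarrow{\ \varepsilon^\Diamond_\emptyset\ }\Diamond$. That is, the functor to $S5_{\Box\Diamond triv}$ from the linearly ordered set $\{0<1<2\}$, regarded as a category, that sends $0,1,2$ to $\Box,\emptyset,\Diamond$, the arrow $0\to1$ to $\varepsilon^\Box_\emptyset$ and the arrow $1\to2$ to $\varepsilon^\Diamond_\emptyset$ is an equivalence of categories. (Isomorphic objects of the source of this functor are equal.) \end{itemize} -/

import Mathlib

open CategoryTheory

namespace S5Modal

/-- The two modal operators. -/
inductive Op : Type
  | box : Op
  | dia : Op

/-- Modalities: finite, possibly empty, sequences of the two operators, leftmost operator first. -/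
abbrev Modality : Type := List Op

/-- Arrow terms `f : A ⊢ B`.
`deltaBox M A` is `δ^{□M}_A : MA ⊢ □MA` and `deltaDia M A` is `δ^{◇M}_A : ◇MA ⊢ MA`. -/
inductive Term : Modality → Modality → Type
  | id (A : Modality) : Term A A
  | epsBox (A : Modality) : Term (Op.box :: A) A
  | epsDia (A : Modality) : Term A (Op.dia :: A)
  | deltaBox (M : Op) (A : Modality) : Term (M :: A) (Op.box :: M :: A)
  | deltaDia (M : Op) (A : Modality) : Term (Op.dia :: M :: A) (M :: A)
  | comp {A B C : Modality} (g : Term B C) (f : Term A B) : Term A C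
  | map (M : Op) {A B : Modality} (f : Term A B) : Term (M :: A) (M :: B)

namespace Term

scoped infixr:80 " ⊚ " => Term.comp

/-- `□f`. -/
abbrev box {A B : Modality} (f : Term A B) : Term (Op.box :: A) (Op.box :: B) := map Op.box f

/-- `◇f`. -/
abbrev dia {A B : Modality} (f : Term A B) : Term (Op.dia :: A) (Op.dia :: B) := map Op.dia f

end Term

open scoped Term

/-- A family of pairs of arrow terms of the same type, to be assumed as additional equations. -/
abbrev EquationSet : Type := ∀ A B : Modality, Term A B → Term A B → Prop

open Term in
/-- The least congruence on arrow terms that satisfies the equations of `S5_{□◇}` and the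
additional equations `X`. -/
inductive TermEq (X : EquationSet) : ∀ {A B : Modality}, Term A B → Term A B → Prop
  -- equality is a congruence
  | refl {A B : Modality} (f : Term A B) : TermEq X f f
  | symm {A B : Modality} {f g : Term A B} : TermEq X f g → TermEq X g f
  | trans {A B : Modality} {f g h : Term A B} : TermEq X f g → TermEq X g h → TermEq X f h
  | comp_congr {A B C : Modality} {g g' : Term B C} {f f' : Term A B} :
      TermEq X g g' → TermEq X f f' → TermEq X (g ⊚ f) (g' ⊚ f')
  | map_congr (M : Op) {A B : Modality} {f f' : Term A B} :
      TermEq X f f' → TermEq X (map M f) (map M f')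
  -- categorial equations
  | comp_id {A B : Modality} (f : Term A B) : TermEq X (f ⊚ id A) f
  | id_comp {A B : Modality} (f : Term A B) : TermEq X (id B ⊚ f) f
  | assoc {A B C D : Modality} (h : Term C D) (g : Term B C) (f : Term A B) :
      TermEq X (h ⊚ (g ⊚ f)) ((h ⊚ g) ⊚ f)
  -- functorial equations
  | map_id (M : Op) (A : Modality) : TermEq X (map M (id A)) (id (M :: A))
  | map_comp (M : Op) {A B C : Modality} (g : Term B C) (f : Term A B) :
      TermEq X (map M (g ⊚ f)) (map M g ⊚ map M f)
  -- naturality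
  | epsBox_nat {A B : Modality} (f : Term A B) :
      TermEq X (epsBox B ⊚ box f) (f ⊚ epsBox A)
  | epsDia_nat {A B : Modality} (f : Term A B) :
      TermEq X (dia f ⊚ epsDia A) (epsDia B ⊚ f)
  | deltaBox_nat (M : Op) {A B : Modality} (f : Term A B) :
      TermEq X (box (map M f) ⊚ deltaBox M A) (deltaBox M B ⊚ map M f)
  | deltaDia_nat (M : Op) {A B : Modality} (f : Term A B) :
      TermEq X (deltaDia M B ⊚ dia (map M f)) (map M f ⊚ deltaDia M A)
  -- associativity of `δ`
  | deltaBox_deltaBox (M : Op) (A : Modality) :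
      TermEq X (box (deltaBox M A) ⊚ deltaBox M A) (deltaBox Op.box (M :: A) ⊚ deltaBox M A)
  | deltaDia_deltaDia (M : Op) (A : Modality) :
      TermEq X (deltaDia M A ⊚ dia (deltaDia M A)) (deltaDia M A ⊚ deltaDia Op.dia (M :: A))
  -- the `β` equations, for both operators `M`
  | box_beta (M : Op) (A : Modality) :
      TermEq X (epsBox (M :: A) ⊚ deltaBox M A) (id (M :: A))
  | dia_beta (M : Op) (A : Modality) :
      TermEq X (deltaDia M A ⊚ epsDia (M :: A)) (id (M :: A))
  -- the `η` equations
  | box_eta (A : Modality) :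
      TermEq X (box (epsBox A) ⊚ deltaBox Op.box A) (id (Op.box :: A))
  | dia_eta (A : Modality) :
      TermEq X (deltaDia Op.dia A ⊚ dia (epsDia A)) (id (Op.dia :: A))
  -- the Frobenius-like equations
  | delta_N (M : Op) (A : Modality) :
      TermEq X (box (deltaDia M A) ⊚ deltaBox Op.dia (M :: A)) (deltaBox M A ⊚ deltaDia M A)
  | delta_I (M : Op) (A : Modality) :
      TermEq X (deltaDia Op.box (M :: A) ⊚ dia (deltaBox M A)) (deltaBox M A ⊚ deltaDia M A)
  -- the additional equations
  | extra {A B : Modality} {f g : Term A B} : X A B f g → TermEq X f g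

/-- Equality of arrow terms, as a setoid. -/
def termSetoid (X : EquationSet) (A B : Modality) : Setoid (Term A B) where
  r := TermEq X
  iseqv := ⟨TermEq.refl, TermEq.symm, TermEq.trans⟩

/-- The extension of the category `S5_{□◇}` with the equations `X`: objects are modalities,
arrows are classes of arrow terms. -/
def S5Ext (_X : EquationSet) : Type := Modality

instance (X : EquationSet) : Category (S5Ext X) where
  Hom A B := Quotient (termSetoid X A B)
  id A := Quotient.mk (termSetoid X A A) (Term.id A)
  comp {A B C} f g :=
    Quotient.map₂ (sa := termSetoid X A B) (sb := termSetoid X B C) (sc := termSetoid X A C)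
      (fun f g => g ⊚ f) (fun _ _ hf _ _ hg => TermEq.comp_congr hg hf) f g
  id_comp := by
    rintro A B ⟨f⟩
    exact Quotient.sound (s := termSetoid X A B) (TermEq.comp_id f)
  comp_id := by
    rintro A B ⟨f⟩
    exact Quotient.sound (s := termSetoid X A B) (TermEq.id_comp f)
  assoc := by
    rintro A B C D ⟨f⟩ ⟨g⟩ ⟨h⟩
    exact Quotient.sound (s := termSetoid X A D) (TermEq.assoc h g f)

/-- A modality as an object of the extension. -/
def S5Ext.obj (X : EquationSet) (A : Modality) : S5Ext X := A

/-- The arrow that is named by an arrow term. -/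
def S5Ext.arrow (X : EquationSet) {A B : Modality} (f : Term A B) :
    S5Ext.obj X A ⟶ S5Ext.obj X B :=
  Quotient.mk (termSetoid X A B) f

/-- Names of the six preordering equations. -/
inductive PreorderingEquation : Type
  | boxEpsBox
  | capBoxBox
  | boxEpsDia
  | diaEpsBox
  | cupDiaDia
  | diaEpsDia

open Term in
/-- The preordering equations, each assumed for all modalities `A`. -/
inductive PreorderingEquation.Instances : PreorderingEquation → EquationSet
  /-- `□ε^□_A = ε^□_{□A}` -/
  | boxEpsBox (A : Modality) :
      Instances .boxEpsBox (Op.box :: Op.box :: A) (Op.box :: A)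
        (box (epsBox A))
        (epsBox (Op.box :: A))
  /-- `ε^□_A ∘ ε^□_{□A} ∘ δ^{◇□}_{□A} = ε^□_A ∘ δ^{◇□}_A ∘ ◇ε^□_{□A}` -/
  | capBoxBox (A : Modality) :
      Instances .capBoxBox (Op.dia :: Op.box :: Op.box :: A) A
        (epsBox A ⊚ epsBox (Op.box :: A) ⊚ deltaDia Op.box (Op.box :: A))
        (epsBox A ⊚ deltaDia Op.box A ⊚ dia (epsBox (Op.box :: A)))
  /-- `□ε^◇_A = δ^{□◇}_A ∘ ε^◇_A ∘ ε^□_A` -/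
  | boxEpsDia (A : Modality) :
      Instances .boxEpsDia (Op.box :: A) (Op.box :: Op.dia :: A)
        (box (epsDia A))
        (deltaBox Op.dia A ⊚ epsDia A ⊚ epsBox A)
  /-- `ε^◇_A ∘ ε^□_A ∘ δ^{◇□}_A = ◇ε^□_A` -/
  | diaEpsBox (A : Modality) :
      Instances .diaEpsBox (Op.dia :: Op.box :: A) (Op.dia :: A)
        (epsDia A ⊚ epsBox A ⊚ deltaDia Op.box A)
        (dia (epsBox A))
  /-- `□ε^◇_{◇A} ∘ δ^{□◇}_A ∘ ε^◇_A = δ^{□◇}_{◇A} ∘ ε^◇_{◇A} ∘ ε^◇_A` -/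
  | cupDiaDia (A : Modality) :
      Instances .cupDiaDia A (Op.box :: Op.dia :: Op.dia :: A)
        (box (epsDia (Op.dia :: A)) ⊚ deltaBox Op.dia A ⊚ epsDia A)
        (deltaBox Op.dia (Op.dia :: A) ⊚ epsDia (Op.dia :: A) ⊚ epsDia A)
  /-- `ε^◇_{◇A} = ◇ε^◇_A` -/
  | diaEpsDia (A : Modality) :
      Instances .diaEpsDia (Op.dia :: A) (Op.dia :: Op.dia :: A)
        (epsDia (Op.dia :: A))
        (dia (epsDia A))

/-- The category `S5_{□◇triv}`, defined with the preordering equation `e`. -/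
abbrev S5Triv (e : PreorderingEquation) : Type := S5Ext e.Instances

/-- The diagram `□ ⟶ ∅ ⟶ ◇` in `S5_{□◇triv}`, with arrows `ε^□` and `ε^◇`, as a functor from the
linearly ordered category `0 < 1 < 2`. -/
def skeletonDiagram (e : PreorderingEquation) : Fin 3 ⥤ S5Triv e :=
  ComposableArrows.mk₂
    (S5Ext.arrow e.Instances (Term.epsBox []))
    (S5Ext.arrow e.Instances (Term.epsDia []))

end S5Modal

namespace S5Modal

/-! Each preordering equation forces the comonad `□` to be idempotent (`boxIdem_structure`).
Equation 1 is idempotence itself, 2 is its transpose under the adjunction `◇ ⊣ □`, and 3 makes `ε^□`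
invertible on boxed objects. Equations 4, 5, 6 are the duals of 3, 2, 1 under reversing arrows and
exchanging `□` with `◇`; they give idempotence of `◇`, and the adjunction carries this over to `□`.

Idempotence makes every `ε^□_{MA}` and `δ^{◇M}_A` invertible. Absorbing operators from the innermost
outwards thus yields an isomorphism `reduction` from each modality to `□`, `∅` or `◇`. By induction
on terms, these isomorphisms turn every arrow into the image of an inequality in `0 < 1 < 2`
(`arrow_reduction`), so parallel arrows agree. Fullness holds because the value in the chain never
decreases along a term (`Term.skel_le`). -/

/-- The dual operator. -/
def Op.dual : Op → Op
  | .box => .dia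
  | .dia => .box

/-! ### Abstract `S5_{□◇}` structures: duality and the adjunction `◇ ⊣ □`. -/

/-- The structure of an `S5_{□◇}` category, with composition in diagrammatic order. -/
structure S5Structure (C : Type*) [Category C] where
  op : Op → C ⥤ C
  epsBox (A : C) : (op .box).obj A ⟶ A
  epsDia (A : C) : A ⟶ (op .dia).obj A
  deltaBox (M : Op) (A : C) : (op M).obj A ⟶ (op .box).obj ((op M).obj A)
  deltaDia (M : Op) (A : C) : (op .dia).obj ((op M).obj A) ⟶ (op M).obj A
  epsBox_nat {A B : C} (f : A ⟶ B) : (op .box).map f ≫ epsBox B = epsBox A ≫ f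
  epsDia_nat {A B : C} (f : A ⟶ B) : f ≫ epsDia B = epsDia A ≫ (op .dia).map f
  deltaBox_nat (M : Op) {A B : C} (f : A ⟶ B) :
    (op M).map f ≫ deltaBox M B = deltaBox M A ≫ (op .box).map ((op M).map f)
  deltaDia_nat (M : Op) {A B : C} (f : A ⟶ B) :
    (op .dia).map ((op M).map f) ≫ deltaDia M B = deltaDia M A ≫ (op M).map f
  box_beta (M : Op) (A : C) : deltaBox M A ≫ epsBox ((op M).obj A) = 𝟙 _
  dia_beta (M : Op) (A : C) : epsDia ((op M).obj A) ≫ deltaDia M A = 𝟙 _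
  box_eta (A : C) : deltaBox .box A ≫ (op .box).map (epsBox A) = 𝟙 _
  dia_eta (A : C) : (op .dia).map (epsDia A) ≫ deltaDia .dia A = 𝟙 _
  delta_N (M : Op) (A : C) :
    deltaBox .dia ((op M).obj A) ≫ (op .box).map (deltaDia M A) = deltaDia M A ≫ deltaBox M A
  delta_I (M : Op) (A : C) :
    (op .dia).map (deltaBox M A) ≫ deltaDia .box ((op M).obj A) = deltaDia M A ≫ deltaBox M A

namespace S5Structure

variable {C : Type*} [Category C] (S : S5Structure C)

/-- The opposite structure, which exchanges `□` and `◇`. -/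
def opposite : S5Structure Cᵒᵖ where
  op M := (S.op M.dual).op
  epsBox A := (S.epsDia A.unop).op
  epsDia A := (S.epsBox A.unop).op
  deltaBox M A := (S.deltaDia M.dual A.unop).op
  deltaDia M A := (S.deltaBox M.dual A.unop).op
  epsBox_nat f := congrArg Quiver.Hom.op (S.epsDia_nat f.unop).symm
  epsDia_nat f := congrArg Quiver.Hom.op (S.epsBox_nat f.unop).symm
  deltaBox_nat M _ _ f := congrArg Quiver.Hom.op (S.deltaDia_nat M.dual f.unop).symm
  deltaDia_nat M _ _ f := congrArg Quiver.Hom.op (S.deltaBox_nat M.dual f.unop).symm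
  box_beta M A := congrArg Quiver.Hom.op (S.dia_beta M.dual A.unop)
  dia_beta M A := congrArg Quiver.Hom.op (S.box_beta M.dual A.unop)
  box_eta A := congrArg Quiver.Hom.op (S.dia_eta A.unop)
  dia_eta A := congrArg Quiver.Hom.op (S.box_eta A.unop)
  delta_N M A := congrArg Quiver.Hom.op (S.delta_I M.dual A.unop)
  delta_I M A := congrArg Quiver.Hom.op (S.delta_N M.dual A.unop)

/-- The transpose of an arrow along the adjunction `◇ ⊣ □`. -/
def transpose {A B : C} (g : (S.op .dia).obj A ⟶ B) : A ⟶ (S.op .box).obj B :=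
  S.epsDia A ≫ S.deltaBox .dia A ≫ (S.op .box).map g

/-- One half of the adjunction, with counit `ε^□ ∘ δ^{◇□}`: `delta_I` reduces it to `box_beta` and
`dia_eta`. -/
lemma transpose_inv {A B : C} (g : (S.op .dia).obj A ⟶ B) :
    (S.op .dia).map (S.transpose g) ≫ S.deltaDia .box B ≫ S.epsBox B = g := by
  have h := S.deltaDia_nat .box g
  simp only [transpose, Functor.map_comp, Category.assoc]
  rw [reassoc_of% h, reassoc_of% (S.delta_I .dia A), S.epsBox_nat,
    reassoc_of% (S.box_beta .dia A), reassoc_of% (S.dia_eta A)]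

lemma transpose_injective {A B : C} {g g' : (S.op .dia).obj A ⟶ B}
    (h : S.transpose g = S.transpose g') : g = g' := by
  rw [← S.transpose_inv g, h, S.transpose_inv]

lemma transpose_counit {A B : C} (h : A ⟶ (S.op .box).obj B) :
    S.transpose ((S.op .dia).map h ≫ S.deltaDia .box B ≫ S.epsBox B) = h := by
  simp only [transpose, Functor.map_comp]
  rw [← reassoc_of% (S.deltaBox_nat .dia h), ← reassoc_of% (S.epsDia_nat h),
    reassoc_of% (S.delta_N .box B), S.box_eta, Category.comp_id, S.dia_beta, Category.comp_id]

/-! ### Idempotence, and the equations that imply it. -/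

/-- The comonad `□` is idempotent. -/
def BoxIdem : Prop := ∀ A, (S.op .box).map (S.epsBox A) = S.epsBox ((S.op .box).obj A)

/-- The monad `◇` is idempotent. -/
def DiaIdem : Prop := ∀ A, (S.op .dia).map (S.epsDia A) = S.epsDia ((S.op .dia).obj A)

variable {S}

/-- Naturality of `ε^□` at `δ^{□M}` and idempotence turn the composite into `□` applied to the `β`
equation. -/
lemma BoxIdem.epsBox_deltaBox (h : S.BoxIdem) (M : Op) (A : C) :
    S.epsBox ((S.op M).obj A) ≫ S.deltaBox M A = 𝟙 _ := by
  rw [← S.epsBox_nat, ← h, ← Functor.map_comp, S.box_beta, CategoryTheory.Functor.map_id]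

lemma BoxIdem.isIso_epsBox (h : S.BoxIdem) (M : Op) (A : C) :
    IsIso (S.epsBox ((S.op M).obj A)) :=
  ⟨_, h.epsBox_deltaBox M A, S.box_beta M A⟩

lemma boxIdem_of_epsBox_deltaBox
    (h : ∀ A, S.epsBox ((S.op .box).obj A) ≫ S.deltaBox .box A = 𝟙 _) : S.BoxIdem := fun A => by
  rw [← Category.id_comp ((S.op .box).map (S.epsBox A)), ← h, Category.assoc, S.box_eta,
    Category.comp_id]

lemma DiaIdem.opposite (h : S.DiaIdem) : S.opposite.BoxIdem :=
  fun A => congrArg Quiver.Hom.op (h A.unop)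

lemma DiaIdem.deltaDia_epsDia (h : S.DiaIdem) (M : Op) (A : C) :
    S.deltaDia M A ≫ S.epsDia ((S.op M).obj A) = 𝟙 _ := by
  cases M
  · exact congrArg Quiver.Hom.unop (h.opposite.epsBox_deltaBox .dia (.op A))
  · exact congrArg Quiver.Hom.unop (h.opposite.epsBox_deltaBox .box (.op A))

/-- The adjunction moves the question for `◇` to one about arrows into a boxed object, where the
invertible `ε^□` can be cancelled. -/
lemma BoxIdem.diaIdem (h : S.BoxIdem) : S.DiaIdem := by
  have := h.isIso_epsBox
  have key : ∀ A, S.deltaDia .dia A ≫ S.epsDia ((S.op .dia).obj A) = 𝟙 _ := fun A => by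
    apply S.transpose_injective
    simp only [transpose, Functor.map_comp, CategoryTheory.Functor.map_id, Category.comp_id]
    rw [reassoc_of% (S.delta_N .dia A), reassoc_of% (S.dia_beta .dia A),
      ← cancel_mono (S.epsBox _), Category.assoc, Category.assoc, S.epsBox_nat,
      reassoc_of% (S.box_beta .dia A), S.box_beta, Category.comp_id]
  intro A
  rw [← Category.comp_id ((S.op .dia).map (S.epsDia A)), ← key, ← Category.assoc, S.dia_eta,
    Category.id_comp]

lemma DiaIdem.boxIdem (h : S.DiaIdem) : S.BoxIdem :=
  fun A => congrArg Quiver.Hom.unop (h.opposite.diaIdem (.op A))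

/-- The two sides of the hypothesis correspond, under `◇ ⊣ □`, to `□ε^□` and `ε^□_□`. -/
lemma boxIdem_of_cap
    (h : ∀ A, S.deltaDia .box ((S.op .box).obj A) ≫ S.epsBox _ ≫ S.epsBox A =
      (S.op .dia).map (S.epsBox ((S.op .box).obj A)) ≫ S.deltaDia .box A ≫ S.epsBox A) :
    S.BoxIdem := fun A => by
  rw [← S.transpose_counit (S.epsBox ((S.op .box).obj A)), ← h,
    ← S.transpose_counit ((S.op .box).map (S.epsBox A)), reassoc_of% (S.deltaDia_nat .box),
    S.epsBox_nat]

/-- The identity of `□□A` is `□` of a `β` equation; the hypothesis at `□A` and `delta_N` rewrite it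
as `δ^{□□} ∘ ε^□`. -/
lemma boxIdem_of_map_epsDia
    (h : ∀ A, (S.op .box).map (S.epsDia A) = S.epsBox A ≫ S.epsDia A ≫ S.deltaBox .dia A) :
    S.BoxIdem := boxIdem_of_epsBox_deltaBox fun A => by
  rw [← CategoryTheory.Functor.map_id, ← S.dia_beta .box A, Functor.map_comp, h, Category.assoc, Category.assoc,
    S.delta_N, reassoc_of% (S.dia_beta .box A)]

lemma boxIdem_of_cup
    (h : ∀ A, S.epsDia A ≫ S.deltaBox .dia A ≫ (S.op .box).map (S.epsDia ((S.op .dia).obj A)) =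
      S.epsDia A ≫ S.epsDia _ ≫ S.deltaBox .dia ((S.op .dia).obj A)) :
    S.BoxIdem := by
  have : S.opposite.BoxIdem := boxIdem_of_cap fun A => congrArg Quiver.Hom.op <| by
    have := h A.unop
    simp only [← Category.assoc] at this
    exact this.symm
  exact DiaIdem.boxIdem fun A => congrArg Quiver.Hom.unop (this (.op A))

lemma boxIdem_of_map_epsBox
    (h : ∀ A, S.deltaDia .box A ≫ S.epsBox A ≫ S.epsDia A = (S.op .dia).map (S.epsBox A)) :
    S.BoxIdem := by
  have : S.opposite.BoxIdem := boxIdem_of_map_epsDia fun A => congrArg Quiver.Hom.op <| by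
    have := h A.unop
    simp only [← Category.assoc] at this
    exact this.symm
  exact DiaIdem.boxIdem fun A => congrArg Quiver.Hom.unop (this (.op A))


/-- The diagram `□X ⟶ X ⟶ ◇X`. -/
abbrev diagram (S : S5Structure C) (X : C) : Fin 3 ⥤ C :=
  ComposableArrows.mk₂ (S.epsBox X) (S.epsDia X)

end S5Structure

/-! ### The operators on the three-element chain. -/

/-- The action of the operators on the skeleton `0 < 1 < 2`. -/
def Op.act : Op → Fin 3 → Fin 3
  | .box, 0 => 0
  | .box, 1 => 0
  | .box, 2 => 2
  | .dia, 0 => 0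
  | .dia, 1 => 2
  | .dia, 2 => 2

lemma Op.act_mono : ∀ (M : Op) {i j : Fin 3}, i ≤ j → M.act i ≤ M.act j
  | .box, i, j => (by decide : ∀ i j : Fin 3, i ≤ j → Op.box.act i ≤ Op.box.act j) i j
  | .dia, i, j => (by decide : ∀ i j : Fin 3, i ≤ j → Op.dia.act i ≤ Op.dia.act j) i j

lemma Op.box_act_le : ∀ i : Fin 3, Op.box.act i ≤ i := by decide

lemma Op.le_dia_act : ∀ i : Fin 3, i ≤ Op.dia.act i := by decide

lemma Op.le_box_act_act : ∀ (M : Op) (i : Fin 3), M.act i ≤ Op.box.act (M.act i)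
  | .box => by decide
  | .dia => by decide

lemma Op.dia_act_act_le : ∀ (M : Op) (i : Fin 3), Op.dia.act (M.act i) ≤ M.act i
  | .box => by decide
  | .dia => by decide

namespace S5Structure

variable {C : Type*} [Category C] {S : S5Structure C}

/-- The operator `M` acts on `diagram S X` as `M.act`, up to isomorphism. -/
def actHom (S : S5Structure C) (X : C) : ∀ (M : Op) (i : Fin 3),
    (S.op M).obj ((S.diagram X).obj i) ⟶ (S.diagram X).obj (M.act i)
  | .box, 0 => S.epsBox ((S.op .box).obj X)
  | .box, 1 => 𝟙 ((S.op .box).obj X)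
  | .box, 2 => S.epsBox ((S.op .dia).obj X)
  | .dia, 0 => S.deltaDia .box X
  | .dia, 1 => 𝟙 ((S.op .dia).obj X)
  | .dia, 2 => S.deltaDia .dia X

lemma DiaIdem.isIso_deltaDia (h : S.DiaIdem) (M : Op) (A : C) : IsIso (S.deltaDia M A) :=
  ⟨_, h.deltaDia_epsDia M A, S.dia_beta M A⟩

lemma BoxIdem.isIso_actHom (h : S.BoxIdem) (X : C) :
    ∀ (M : Op) (i : Fin 3), IsIso (S.actHom X M i)
  | .box, 0 => h.isIso_epsBox .box X
  | .box, 1 => inferInstanceAs (IsIso (𝟙 ((S.op .box).obj X)))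
  | .box, 2 => h.isIso_epsBox .dia X
  | .dia, 0 => h.diaIdem.isIso_deltaDia .box X
  | .dia, 1 => inferInstanceAs (IsIso (𝟙 ((S.op .dia).obj X)))
  | .dia, 2 => h.diaIdem.isIso_deltaDia .dia X

lemma actHom_box (X : C) : ∀ i : Fin 3,
    S.actHom X .box i ≫ (S.diagram X).map (homOfLE (Op.box_act_le i)) = S.epsBox _
  | 0 => Category.comp_id _
  | 1 => Category.id_comp _
  | 2 => Category.comp_id _

lemma actHom_dia (X : C) : ∀ i : Fin 3,
    S.epsDia _ ≫ S.actHom X .dia i = (S.diagram X).map (homOfLE (Op.le_dia_act i))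
  | 0 => S.dia_beta .box X
  | 1 => Category.comp_id _
  | 2 => S.dia_beta .dia X

lemma BoxIdem.deltaDia_epsBox_epsDia (h : S.BoxIdem) (X : C) :
    S.deltaDia .box X ≫ S.epsBox X ≫ S.epsDia X = (S.op .dia).map (S.epsBox X) := by
  rw [S.epsDia_nat, reassoc_of% (h.diaIdem.deltaDia_epsDia .box X)]

/-- Naturality needs checking only on `0 ≤ 1` and `1 ≤ 2`; idempotence enters only at `0 ≤ 1`. -/
lemma BoxIdem.actHom_nat (h : S.BoxIdem) (X : C) (M : Op) {i j : Fin 3} (hij : i ≤ j) :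
    (S.op M).map ((S.diagram X).map (homOfLE hij)) ≫ S.actHom X M j =
      S.actHom X M i ≫ (S.diagram X).map (homOfLE (M.act_mono hij)) := by
  have refl (i : Fin 3) : (S.op M).map ((S.diagram X).map (homOfLE (le_refl i))) ≫
      S.actHom X M i = S.actHom X M i ≫ (S.diagram X).map (homOfLE (M.act_mono (le_refl i))) := by
    have h₁ (i : Fin 3) : (S.diagram X).map (homOfLE (le_refl i)) = 𝟙 _ :=
      (S.diagram X).map_id i
    rw [h₁, h₁, CategoryTheory.Functor.map_id, Category.id_comp, Category.comp_id]
  have h01 : (S.op M).map ((S.diagram X).map (homOfLE (by decide : (0 : Fin 3) ≤ 1))) ≫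
      S.actHom X M 1 =
        S.actHom X M 0 ≫ (S.diagram X).map (homOfLE (M.act_mono (by decide))) := by
    cases M
    · exact congrArg (· ≫ 𝟙 ((S.op .box).obj X)) (h X)
    · exact (Category.comp_id _).trans (h.deltaDia_epsBox_epsDia X).symm
  have h12 : (S.op M).map ((S.diagram X).map (homOfLE (by decide : (1 : Fin 3) ≤ 2))) ≫
      S.actHom X M 2 =
        S.actHom X M 1 ≫ (S.diagram X).map (homOfLE (M.act_mono (by decide))) := by
    cases M
    · exact (S.epsBox_nat (S.epsDia X)).trans (Category.id_comp _).symm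
    · exact (S.dia_eta X).trans (Category.comp_id _).symm
  have h02 : (S.op M).map ((S.diagram X).map (homOfLE (by decide : (0 : Fin 3) ≤ 2))) ≫
      S.actHom X M 2 =
        S.actHom X M 0 ≫ (S.diagram X).map (homOfLE (M.act_mono (by decide))) := by
    rw [← homOfLE_comp (by decide : (0 : Fin 3) ≤ 1) (by decide : (1 : Fin 3) ≤ 2),
      Functor.map_comp, Functor.map_comp, Category.assoc, h12, reassoc_of% h01,
      ← Functor.map_comp, homOfLE_comp]
  match i, j, hij with
  | 0, 0, _ => exact refl 0
  | 1, 1, _ => exact refl 1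
  | 2, 2, _ => exact refl 2
  | 0, 1, _ => exact h01
  | 1, 2, _ => exact h12
  | 0, 2, _ => exact h02

end S5Structure

/-! ### The category of arrow terms as an instance. -/

/-- The `S5_{□◇}` structure of the category of arrow terms. -/
def S5Ext.structure (X : EquationSet) : S5Structure (S5Ext X) where
  op M :=
    { obj A := M :: (show Modality from A)
      map {A B} := Quotient.map (sa := termSetoid X A B)
        (sb := termSetoid X (M :: (show Modality from A)) (M :: (show Modality from B)))
        (Term.map M) fun _ _ => TermEq.map_congr M
      map_id A := Quotient.sound (TermEq.map_id M A)
      map_comp := by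
        rintro A B D ⟨f⟩ ⟨g⟩
        exact Quotient.sound (TermEq.map_comp M g f) }
  epsBox A := S5Ext.arrow X (Term.epsBox A)
  epsDia A := S5Ext.arrow X (Term.epsDia A)
  deltaBox M A := S5Ext.arrow X (Term.deltaBox M A)
  deltaDia M A := S5Ext.arrow X (Term.deltaDia M A)
  epsBox_nat := by
    rintro A B ⟨f⟩
    exact Quotient.sound (TermEq.epsBox_nat f)
  epsDia_nat := by
    rintro A B ⟨f⟩
    exact Quotient.sound (TermEq.epsDia_nat f).symm
  deltaBox_nat := by
    rintro M A B ⟨f⟩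
    exact Quotient.sound (TermEq.deltaBox_nat M f).symm
  deltaDia_nat := by
    rintro M A B ⟨f⟩
    exact Quotient.sound (TermEq.deltaDia_nat M f)
  box_beta M A := Quotient.sound (TermEq.box_beta M A)
  dia_beta M A := Quotient.sound (TermEq.dia_beta M A)
  box_eta A := Quotient.sound (TermEq.box_eta A)
  dia_eta A := Quotient.sound (TermEq.dia_eta A)
  delta_N M A := Quotient.sound (TermEq.delta_N M A)
  delta_I M A := Quotient.sound (TermEq.delta_I M A)

/-- Each of the preordering equations makes `□` idempotent. -/
lemma boxIdem_structure (e : PreorderingEquation) : (S5Ext.structure e.Instances).BoxIdem := by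
  cases e
  · exact fun A => Quotient.sound (.extra (.boxEpsBox A))
  · refine S5Structure.boxIdem_of_cap fun A => Quotient.sound ?_
    exact (TermEq.assoc _ _ _).symm.trans (.trans (.extra (.capBoxBox A)) (.assoc _ _ _))
  · refine S5Structure.boxIdem_of_map_epsDia fun A => Quotient.sound ?_
    exact .trans (.extra (.boxEpsDia A)) (.assoc _ _ _)
  · refine S5Structure.boxIdem_of_map_epsBox fun A => Quotient.sound ?_
    exact (TermEq.assoc _ _ _).symm.trans (.extra (.diaEpsBox A))
  · refine S5Structure.boxIdem_of_cup fun A => Quotient.sound ?_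
    exact (TermEq.assoc _ _ _).symm.trans (.trans (.extra (.cupDiaDia A)) (.assoc _ _ _))
  · exact S5Structure.DiaIdem.boxIdem fun A =>
      Quotient.sound (TermEq.extra (.diaEpsDia A)).symm

/-! ### Reduction to the chain, thinness and the equivalence. -/

/-- The object of the skeleton isomorphic to a modality. -/
def Modality.skel : Modality → Fin 3
  | [] => 1
  | M :: A => M.act (Modality.skel A)

lemma Term.skel_le {A B : Modality} (f : Term A B) : Modality.skel A ≤ Modality.skel B := by
  induction f with
  | id => exact le_rfl
  | epsBox => exact Op.box_act_le _
  | epsDia => exact Op.le_dia_act _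
  | deltaBox => exact Op.le_box_act_act _ _
  | deltaDia => exact Op.dia_act_act_le _ _
  | comp g f hg hf => exact hf.trans hg
  | map M f h => exact M.act_mono h

/-- The reduction of a modality to its isomorphic object of the skeleton. -/
def reduction (e : PreorderingEquation) : ∀ A : Modality,
    S5Ext.obj e.Instances A ⟶ (skeletonDiagram e).obj (Modality.skel A)
  | [] => 𝟙 (S5Ext.obj e.Instances [])
  | M :: A => ((S5Ext.structure e.Instances).op M).map (reduction e A) ≫
      (S5Ext.structure e.Instances).actHom (S5Ext.obj e.Instances []) M (Modality.skel A)

instance isIso_reduction (e : PreorderingEquation) : ∀ A : Modality, IsIso (reduction e A)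
  | [] => inferInstanceAs (IsIso (𝟙 (S5Ext.obj e.Instances [])))
  | M :: A => by
    have := isIso_reduction e A
    have := (boxIdem_structure e).isIso_actHom (S5Ext.obj e.Instances []) M (Modality.skel A)
    exact @IsIso.comp_isIso _ _ _ _ _ (((S5Ext.structure e.Instances).op M).map (reduction e A)) _
      inferInstance this

/-- The right side depends only on the endpoints of `f`, which is what makes parallel arrows equal.
-/
lemma arrow_reduction (e : PreorderingEquation) {A B : Modality} (f : Term A B) :
    S5Ext.arrow e.Instances f ≫ reduction e B =
      reduction e A ≫ (skeletonDiagram e).map (homOfLE f.skel_le) := by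
  have hI := boxIdem_structure e
  set S := S5Ext.structure e.Instances
  have box (A : Modality) : reduction e (.box :: A) ≫
      (skeletonDiagram e).map (homOfLE (Op.box_act_le _)) = S.epsBox A ≫ reduction e A := by
    refine (Category.assoc _ _ _).trans ?_
    refine (congrArg _ (S.actHom_box _ _)).trans ?_
    exact S.epsBox_nat _
  have dia (A : Modality) : S.epsDia A ≫ reduction e (.dia :: A) =
      reduction e A ≫ (skeletonDiagram e).map (homOfLE (Op.le_dia_act _)) := by
    refine (Category.assoc _ _ _).symm.trans ?_
    refine (congrArg (· ≫ _) (S.epsDia_nat _).symm).trans ?_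
    refine (Category.assoc _ _ _).trans ?_
    exact congrArg _ (S.actHom_dia _ _)
  induction f with
  | id A =>
    refine (Category.id_comp _).trans ?_
    exact ((congrArg _ ((skeletonDiagram e).map_id _)).trans (Category.comp_id _)).symm
  | epsBox A => exact (box A).symm
  | epsDia A => exact dia A
  | deltaBox M A =>
    -- Values of `M.act` are fixed by `□`, so this inequality is an equality. Composing with its
    -- image brings in `ε^□`, which `δ^{□M}` splits.
    have : IsIso ((skeletonDiagram e).map (homOfLE (Op.box_act_le (Modality.skel (M :: A))))) :=
      ⟨(skeletonDiagram e).map (homOfLE (Op.le_box_act_act M _)),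
        ((skeletonDiagram e).map_comp _ _).symm.trans ((skeletonDiagram e).map_id _),
        ((skeletonDiagram e).map_comp _ _).symm.trans ((skeletonDiagram e).map_id _)⟩
    refine (cancel_mono ((skeletonDiagram e).map
      (homOfLE (Op.box_act_le (Modality.skel (M :: A)))))).1 ?_
    refine (Category.assoc _ _ _).trans ?_
    refine (congrArg _ (box (M :: A))).trans ?_
    refine (Category.assoc _ _ _).symm.trans ?_
    refine (congrArg (· ≫ _) (S.box_beta M A)).trans ?_
    refine (Category.id_comp _).trans ?_
    refine .symm <| (Category.assoc _ _ _).trans ?_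
    refine (congrArg _ ((skeletonDiagram e).map_comp _ _).symm).trans ?_
    exact (congrArg _ ((skeletonDiagram e).map_id _)).trans (Category.comp_id _)
  | deltaDia M A =>
    -- By idempotence `ε^◇_{MA}` is inverse to `δ^{◇M}_A`; cancelling it reduces the claim to the
    -- case of `ε^◇`.
    have : IsIso (S.epsDia ((S.op M).obj A)) :=
      ⟨_, S.dia_beta M A, hI.diaIdem.deltaDia_epsDia M A⟩
    refine (cancel_epi (S.epsDia ((S.op M).obj A))).1 ?_
    refine (Category.assoc _ _ _).symm.trans ?_
    refine (congrArg (· ≫ _) (S.dia_beta M A)).trans ?_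
    refine (Category.id_comp _).trans ?_
    refine .symm <| (Category.assoc _ _ _).symm.trans ?_
    refine (congrArg (· ≫ _) (dia (M :: A))).trans ?_
    refine (Category.assoc _ _ _).trans ?_
    refine (congrArg _ ((skeletonDiagram e).map_comp _ _).symm).trans ?_
    exact (congrArg _ ((skeletonDiagram e).map_id _)).trans (Category.comp_id _)
  | comp g f hg hf =>
    refine (Category.assoc (S5Ext.arrow e.Instances f) (S5Ext.arrow e.Instances g) _).trans ?_
    rw [hg, reassoc_of% hf, ← Functor.map_comp, homOfLE_comp]
  | @map M A B f hf =>
    refine (Category.assoc ((S.op M).map (S5Ext.arrow e.Instances f)) _ _).symm.trans ?_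
    refine (congrArg (· ≫ _) ((S.op M).map_comp _ _).symm).trans ?_
    rw [hf, Functor.map_comp]
    refine (Category.assoc _ _ _).trans ?_
    refine (congrArg _ (hI.actHom_nat _ M f.skel_le)).trans ?_
    exact (Category.assoc _ _ _).symm

lemma arrow_eq (e : PreorderingEquation) {A B : Modality} (f g : Term A B) :
    S5Ext.arrow e.Instances f = S5Ext.arrow e.Instances g := by
  rw [← cancel_mono (reduction e B), arrow_reduction, arrow_reduction]

instance isThin_S5Triv (e : PreorderingEquation) : Quiver.IsThin (S5Triv e) := by
  refine fun A B => ⟨?_⟩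
  rintro ⟨f⟩ ⟨g⟩
  exact arrow_eq e f g

lemma skel_skeletonDiagram (e : PreorderingEquation) :
    ∀ i : Fin 3, Modality.skel ((skeletonDiagram e).obj i) = i
  | 0 => rfl
  | 1 => rfl
  | 2 => rfl

lemma isEquivalence_skeletonDiagram (e : PreorderingEquation) :
    (skeletonDiagram e).IsEquivalence where
  faithful := ⟨fun _ => Subsingleton.elim _ _⟩
  full := ⟨fun {i j} f => by
    -- Any term naming `f` witnesses the inequality `i ≤ j`; thinness then identifies `f` with its
    -- image.
    obtain ⟨f', -⟩ := Quotient.exists_rep f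
    have h := f'.skel_le
    rw [skel_skeletonDiagram, skel_skeletonDiagram] at h
    exact ⟨homOfLE h, Subsingleton.elim _ _⟩⟩
  essSurj := ⟨fun A => ⟨Modality.skel A, ⟨(@asIso _ _ _ _ (reduction e A) (isIso_reduction e A)).symm⟩⟩⟩

end S5Modal

theorem mainTheorem3 (e : S5Modal.PreorderingEquation) :
    Quiver.IsThin (S5Modal.S5Triv e) ∧
      CategoryTheory.IsSkeletonOf (S5Modal.S5Triv e) (Fin 3) (S5Modal.skeletonDiagram e) :=
  ⟨S5Modal.isThin_S5Triv e,
    { skel := fun _ _ ⟨h⟩ => le_antisymm (leOfHom h.hom) (leOfHom h.inv)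
      eqv := S5Modal.isEquivalence_skeletonDiagram e }⟩
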